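/- Let $X$ be an AL-space, that is, a (real) Banach lattice with $\|x+y\|=\|x\|+\|y\|$ for all $x,y\in X_+$. An atom of $X$ is an element $a\in X_+$ such that every $x$ with $0\le x\le a$ is a scalar multiple of $a$. Let $\{e_i\}_{i\in I}$ be a maximal family of (pairwise distinct) norm-one atoms in $X$, and let $e_i^*$ be the coordinate functional of $e_i$: for $f\in X$, $e_i^*(f)$ is the unique real number such that $e_i^*(f)e_i$ is the band projection of $f$ onto the band spanned by $e_i$, i.e. such that $|f-e_i^*(f)e_i|\wedge e_i=0$. A map $P\colon X\times X\to X$ is called an $f$-algebra product if it is bilinear and associative, $P(f,g)\ge 0$ whenever $f,g\ge 0$, and $a\wedge b=0$ implies $P(c,a)\wedge b=0=P(a,c)\wedge b$ for all $c\in X_+$. A map $P\colon X\times X\to X$ is an $f$-algebra product if and only if there exists a weight $w\in\ell_\infty(I)_+$ such that $$P(f,g)=\sum_{i\in I}w(i)\,e_i^*(f)\,e_i^*(g)\,e_i\quad\text{for all } f,g\in X,$$ the sum converging unconditionally in norm; and for every $w\in\ell_\infty(I)_+$ these sums do converge, so that every such $w$ defines an $f$-algebra product. The product given by $w\in\ell_\infty(I)_+$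 is submultiplicative, i.e. $\|P(f,g)\|\le\|f\|\,\|g\|$ for all $f,g\in X$, if and only if $\|w\|_\infty\le 1$. -/

import Mathlib

/-- The norm of a Banach lattice is an L-norm: it is additive on the positive cone.
A Banach lattice with this property is an AL-space. -/
def IsALSpace (X : Type*) [NormedAddCommGroup X] [Lattice X] : Prop :=
  ∀ x y : X, 0 ≤ x → 0 ≤ y → ‖x + y‖ = ‖x‖ + ‖y‖

/-- `a` is an atom of the vector lattice `X`: it is positive, and every `x` with `0 ≤ x ≤ a` is a
scalar multiple of `a`. -/
def IsLatticeAtom {X : Type*} [AddCommGroup X] [Lattice X] [Module ℝ X] (a : X) : Prop :=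
  0 ≤ a ∧ ∀ x : X, 0 ≤ x → x ≤ a → ∃ c : ℝ, x = c • a

/-- `e` is a family of pairwise distinct norm-one atoms, and its set of members is maximal among
all sets of norm-one atoms. -/
structure IsMaximalAtomFamily {X I : Type*} [NormedAddCommGroup X] [Lattice X] [NormedSpace ℝ X]
    (e : I → X) : Prop where
  injective : Function.Injective e
  maximal : Maximal (fun A : Set X => ∀ a ∈ A, IsLatticeAtom a ∧ ‖a‖ = 1) (Set.range e)

/-- The coordinate functional of an atom `a`. The band projection `P` onto the band spanned by `a`
sends `x` to the multiple `P x = t • a` for which `x - P x` is disjoint from `a`; the coordinate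
of `x` is this real number `t`. It exists and is unique whenever `a` is a nonzero atom of a normed
lattice: see `existsUnique_coord` and `coordFunctional_spec`. -/
noncomputable def coordFunctional {X : Type*} [AddCommGroup X] [Lattice X] [Module ℝ X]
    (a x : X) : ℝ :=
  Classical.epsilon fun t : ℝ => |x - t • a| ⊓ |a| = 0

theorem add_inf_eq_zero_of_disjoint {X : Type*} [AddCommGroup X] [Lattice X]
    [IsOrderedAddMonoid X] {y z a : X} (hy : 0 ≤ y) (hz : 0 ≤ z) (ha : 0 ≤ a)
    (hya : y ⊓ a = 0) (hza : z ⊓ a = 0) : (y + z) ⊓ a = 0 := by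
  refine le_antisymm ?_ (le_inf (add_nonneg hy hz) ha)
  rw [← hza]
  refine le_inf ?_ inf_le_right
  have h : (y + z) ⊓ a - z ≤ y ⊓ a :=
    le_inf (sub_le_iff_le_add.2 inf_le_left) ((sub_le_self _ hz).trans inf_le_right)
  rw [hya] at h
  exact sub_nonpos.1 h

theorem exists_coord_of_nonneg {X : Type*} [NormedAddCommGroup X] [Lattice X]
    [IsOrderedAddMonoid X] [HasSolidNorm X] [NormedSpace ℝ X] [IsOrderedModule ℝ X]
    {a : X} (ha : IsLatticeAtom a) (h0 : a ≠ 0) {x : X} (hx : 0 ≤ x) :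
    ∃ t : ℝ, 0 ≤ x - t • a ∧ (x - t • a) ⊓ a = 0 := by
  have hpos : 0 < ‖a‖ := norm_pos_iff.2 h0
  have hne : {t : ℝ | t • a ≤ x}.Nonempty := ⟨0, by simpa using hx⟩
  have hbd : BddAbove {t : ℝ | t • a ≤ x} := by
    refine ⟨‖x‖ / ‖a‖, fun t ht => ?_⟩
    rw [le_div_iff₀ hpos]
    rcases le_total t 0 with h | h
    · exact (mul_nonpos_of_nonpos_of_nonneg h hpos.le).trans (norm_nonneg x)
    · have h1 : ‖t • a‖ ≤ ‖x‖ := norm_le_norm_of_abs_le_abs (by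
        rw [abs_of_nonneg (smul_nonneg h ha.1), abs_of_nonneg hx]; exact ht)
      rwa [norm_smul, Real.norm_of_nonneg h] at h1
  have hcl : IsClosed {t : ℝ | t • a ≤ x} :=
    isClosed_le (by fun_prop) continuous_const
  have hmem : sSup {t : ℝ | t • a ≤ x} • a ≤ x := hcl.csSup_mem hne hbd
  set s := sSup {t : ℝ | t • a ≤ x} with hs
  have hy : 0 ≤ x - s • a := sub_nonneg.2 hmem
  refine ⟨s, hy, ?_⟩
  have hi : 0 ≤ (x - s • a) ⊓ a := le_inf hy ha.1
  obtain ⟨c, hc⟩ := ha.2 _ hi inf_le_right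
  have hcs : s + c ≤ s := le_csSup hbd (by
    have h1 : c • a ≤ x - s • a := hc ▸ inf_le_left
    change (s + c) • a ≤ x
    rw [add_smul, add_comm]
    exact le_sub_iff_add_le.1 h1)
  refine le_antisymm ?_ hi
  rw [hc]
  exact smul_nonpos_of_nonpos_of_nonneg (by linarith) ha.1

theorem existsUnique_coord {X : Type*} [NormedAddCommGroup X] [Lattice X]
    [IsOrderedAddMonoid X] [HasSolidNorm X] [NormedSpace ℝ X] [IsOrderedModule ℝ X]
    {a : X} (ha : IsLatticeAtom a) (h0 : a ≠ 0) (x : X) :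
    ∃! t : ℝ, |x - t • a| ⊓ |a| = 0 := by
  rw [abs_of_nonneg ha.1]
  obtain ⟨t, ht, ht'⟩ := exists_coord_of_nonneg ha h0 (posPart_nonneg x)
  obtain ⟨s, hs, hs'⟩ := exists_coord_of_nonneg ha h0 (negPart_nonneg x)
  have hts : |x - (t - s) • a| ⊓ a = 0 := by
    refine le_antisymm ?_ (le_inf (abs_nonneg _) ha.1)
    rw [← add_inf_eq_zero_of_disjoint ht hs ha.1 ht' hs']
    refine inf_le_inf_right _ ?_
    have h : x - (t - s) • a = (x⁺ - t • a) - (x⁻ - s • a) := by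
      conv_lhs => rw [← posPart_sub_negPart x]
      rw [sub_smul]; abel
    rw [h]
    refine abs_le'.2 ⟨?_, ?_⟩
    · exact (sub_le_self _ hs).trans (le_add_of_nonneg_right hs)
    · rw [neg_sub]
      exact (sub_le_self _ ht).trans (le_add_of_nonneg_left ht)
  refine ⟨t - s, hts, fun r hr => ?_⟩
  · have key : ∀ u v : ℝ, |x - u • a| ⊓ a = 0 → |x - v • a| ⊓ a = 0 → v ≤ u := by
      intro u v hu hv
      by_contra hlt
      rw [not_le] at hlt
      have h1 := add_inf_eq_zero_of_disjoint (abs_nonneg _) (abs_nonneg _) ha.1 hu hv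
      have h2 : (v - u) • a ≤ |x - u • a| + |x - v • a| := by
        have h3 : (v - u) • a = (x - u • a) + -(x - v • a) := by rw [sub_smul]; abel
        rw [h3]
        exact add_le_add (le_abs_self _) (neg_le_abs _)
      have hm : 0 < min (v - u) 1 := lt_min (sub_pos.2 hlt) one_pos
      have h4 : min (v - u) 1 • a ≤ 0 := by
        rw [← h1]
        refine le_inf ((smul_le_smul_of_nonneg_right (min_le_left _ _) ha.1).trans h2) ?_
        exact (smul_le_smul_of_nonneg_right (min_le_right _ _) ha.1).trans_eq (one_smul ℝ a)
      have h5 : min (v - u) 1 • a = 0 := le_antisymm h4 (smul_nonneg hm.le ha.1)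
      rcases smul_eq_zero.1 h5 with h | h
      · exact hm.ne' h
      · exact h0 h
    exact le_antisymm (key _ _ hts hr) (key _ _ hr hts)

theorem coordFunctional_spec {X : Type*} [NormedAddCommGroup X] [Lattice X]
    [IsOrderedAddMonoid X] [HasSolidNorm X] [NormedSpace ℝ X] [IsOrderedModule ℝ X]
    {a : X} (ha : IsLatticeAtom a) (h0 : a ≠ 0) (x : X) :
    |x - coordFunctional a x • a| ⊓ |a| = 0 :=
  Classical.epsilon_spec (existsUnique_coord ha h0 x).exists

/-- `P` is an f-algebra product on the vector lattice `X`: it makes `X` into an (associative, not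
necessarily unital) real algebra in which products of positive elements are positive, and
`a ⊓ b = 0` implies `(c a) ⊓ b = 0 = (a c) ⊓ b` for every positive `c`. -/
structure IsFAlgebraProduct {X : Type*} [AddCommGroup X] [Lattice X] [Module ℝ X]
    (P : X → X → X) : Prop where
  add_left : ∀ f g h, P (f + g) h = P f h + P g h
  add_right : ∀ f g h, P f (g + h) = P f g + P f h
  smul_left : ∀ (r : ℝ) f g, P (r • f) g = r • P f g
  smul_right : ∀ (r : ℝ) f g, P f (r • g) = r • P f g
  assoc : ∀ f g h, P (P f g) h = P f (P g h)
  nonneg : ∀ f g, 0 ≤ f → 0 ≤ g → 0 ≤ P f g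
  inf_eq_zero : ∀ a b c, a ⊓ b = 0 → 0 ≤ c → P c a ⊓ b = 0 ∧ P a c ⊓ b = 0

/-- `P` is submultiplicative for the norm of `X`. -/
def IsSubmultiplicative {X : Type*} [NormedAddCommGroup X] (P : X → X → X) : Prop :=
  ∀ f g, ‖P f g‖ ≤ ‖f‖ * ‖g‖

/-- `P f g = ∑ i, w i * eᵢ*(f) * eᵢ*(g) • eᵢ` for all `f` and `g`, the sum being unconditionally
convergent in norm. -/
def IsWeightedProduct {X I : Type*} [NormedAddCommGroup X] [Lattice X] [NormedSpace ℝ X]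
    (e : I → X) (w : lp (fun _ : I => ℝ) ⊤) (P : X → X → X) : Prop :=
  ∀ f g, HasSum (fun i => (w i * coordFunctional (e i) f * coordFunctional (e i) g) • e i) (P f g)

/-! Disjoint elements have product zero, and the square of an atom `e i` is a multiple `w i • e i`.
Since the norm adds up over disjoint elements, every `f` is the sum of a norm-convergent atomic part
`∑ eᵢ*(f) eᵢ` and a diffuse part disjoint from all atoms. An f-algebra product is automatically
bounded, so the formula follows by continuity once diffuse elements annihilate everything.

That is `mul_self_eq_zero_of_diffuse`. If `x ≥ 0` is diffuse and `P x x ≠ 0`, put `δ = ‖P x x‖ /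
‖x‖` and consider `u ≥ 0` with `δ‖u‖ ≤ ‖P u u‖`. As `‖P u u‖ ≤ K‖u‖²`, the nonzero ones stay away
from zero, and `exists_minimal_of_isClosed` gives a minimal one below `x`. If it splits into two
disjoint parts, the cross products vanish and norms add, so one part inherits the inequality; by
minimality the splitting is trivial. Then `isLatticeAtom_of_components` makes `u` an atom below `x`,
which is absurd.

Conversely, weighted products are checked coordinatewise, and submultiplicativity is tested on the
atoms. -/

set_option linter.unusedSectionVars false

open Filter Topology

/-! ### Scalars and lattice operations -/

section VectorLattice

theorem eq_zero_of_inf_eq_zero_of_le {X : Type*} [AddCommGroup X] [Lattice X] {z u b : X} (hz : 0 ≤ z) (hu : z ≤ u) (hb : z ≤ b)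
    (h : u ⊓ b = 0) : z = 0 :=
  le_antisymm (h ▸ le_inf hu hb) hz

theorem inf_eq_zero_mono {X : Type*} [AddCommGroup X] [Lattice X] {u u' v v' : X} (h : u' ⊓ v' = 0) (hu : 0 ≤ u) (hv : 0 ≤ v)
    (huu : u ≤ u') (hvv : v ≤ v') : u ⊓ v = 0 :=
  le_antisymm (h ▸ inf_le_inf huu hvv) (le_inf hu hv)

theorem abs_smul_real {X : Type*} [AddCommGroup X] [Lattice X] [IsOrderedAddMonoid X]
    [Module ℝ X] [IsOrderedModule ℝ X] (c : ℝ) (y : X) : |c • y| = |c| • |y| := by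
  have key : ∀ (d : ℝ), 0 < d → |d • y| = d • |y| := by
    intro d hd
    apply le_antisymm
    · exact abs_le'.2 ⟨smul_le_smul_of_nonneg_left (le_abs_self y) hd.le, by
        rw [← smul_neg]; exact smul_le_smul_of_nonneg_left (neg_le_abs y) hd.le⟩
    · rw [← le_inv_smul_iff_of_pos hd]
      refine abs_le'.2 ⟨?_, ?_⟩
      · rw [le_inv_smul_iff_of_pos hd]; exact le_abs_self _
      · rw [le_inv_smul_iff_of_pos hd, smul_neg]; exact neg_le_abs _
  rcases lt_trichotomy c 0 with h | h | h
  · rw [abs_of_neg h, ← key (-c) (by linarith), neg_smul, abs_neg]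
  · simp [h]
  · rw [abs_of_pos h, key c h]

/-- Dividing the meet by `c + 1`, which is at least `c` and at least `1`, puts it below both `y` and
`a`. -/
theorem smul_inf_eq_zero {X : Type*} [AddCommGroup X] [Lattice X] [IsOrderedAddMonoid X]
    [Module ℝ X] [IsOrderedModule ℝ X] {y a : X} (h : y ⊓ a = 0) {c : ℝ} (hc : 0 ≤ c) : (c • y) ⊓ a = 0 := by
  have hy : 0 ≤ y := h ▸ inf_le_left
  have ha : 0 ≤ a := h ▸ inf_le_right
  have hm : (0 : ℝ) < c + 1 := by positivity
  have hz : 0 ≤ (c • y) ⊓ a := le_inf (smul_nonneg hc hy) ha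
  have key : (c + 1)⁻¹ • ((c • y) ⊓ a) = 0 := by
    refine eq_zero_of_inf_eq_zero_of_le (smul_nonneg (inv_nonneg.2 hm.le) hz) ?_ ?_ h
    · rw [inv_smul_le_iff_of_pos hm]
      exact inf_le_left.trans (smul_le_smul_of_nonneg_right (by linarith) hy)
    · rw [inv_smul_le_iff_of_pos hm]
      refine inf_le_right.trans ?_
      simpa using smul_le_smul_of_nonneg_right (show (1 : ℝ) ≤ c + 1 by linarith) ha
  exact (smul_eq_zero.1 key).resolve_left (inv_ne_zero hm.ne')

end VectorLattice

/-! ### Disjoint complements as closed subspaces -/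

section Disjointness

variable {X : Type*} [NormedAddCommGroup X] [Lattice X] [IsOrderedAddMonoid X]
  [NormedSpace ℝ X] [IsOrderedModule ℝ X]

/-- The disjoint complement of `a`. -/
def disjointComplement (a : X) : Submodule ℝ X where
  carrier := {y | |y| ⊓ |a| = 0}
  zero_mem' := by simp
  add_mem' {y z} hy hz :=
    inf_eq_zero_mono (add_inf_eq_zero_of_disjoint (abs_nonneg _) (abs_nonneg _) (abs_nonneg _) hy hz)
      (abs_nonneg _) (abs_nonneg _) (abs_add_le y z) le_rfl
  smul_mem' c y hy := by
    change |c • y| ⊓ |a| = 0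
    rw [abs_smul_real]
    exact smul_inf_eq_zero hy (abs_nonneg c)

theorem mem_disjointComplement {a y : X} : y ∈ disjointComplement a ↔ |y| ⊓ |a| = 0 := Iff.rfl

theorem mem_disjointComplement_of_nonneg {a y : X} (ha : 0 ≤ a) (hy : 0 ≤ y) :
    y ∈ disjointComplement a ↔ y ⊓ a = 0 := by
  rw [mem_disjointComplement, abs_of_nonneg ha, abs_of_nonneg hy]

theorem mem_disjointComplement_comm {a y : X} :
    y ∈ disjointComplement a ↔ a ∈ disjointComplement y := by
  rw [mem_disjointComplement, mem_disjointComplement, inf_comm]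

theorem isClosed_disjointComplement [HasSolidNorm X] (a : X) : IsClosed (disjointComplement a : Set X) := by
  have h : Continuous fun y : X => |y| ⊓ |a| := by
    change Continuous fun y : X => (y ⊔ -y) ⊓ |a|
    fun_prop
  exact isClosed_eq h continuous_const

theorem mem_disjointComplement_of_abs_le {a y z : X} (h : y ∈ disjointComplement a)
    (hz : |z| ≤ |y|) : z ∈ disjointComplement a :=
  inf_eq_zero_mono h (abs_nonneg _) (abs_nonneg _) hz le_rfl

theorem eq_zero_of_mem_disjointComplement_self [HasSolidNorm X] {a : X} (h : a ∈ disjointComplement a) : a = 0 := by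
  rw [mem_disjointComplement, inf_idem] at h
  rw [← norm_eq_zero, ← norm_abs_eq_norm, h, norm_zero]

theorem sum_le_of_pairwise_disjoint {I : Type*} {u : I → X} (hu : ∀ i, 0 ≤ u i)
    (hd : ∀ i j, i ≠ j → u i ⊓ u j = 0) {y : X} (hy : 0 ≤ y) (hle : ∀ i, u i ≤ y)
    (F : Finset I) : ∑ i ∈ F, u i ≤ y := by
  classical
  induction F using Finset.induction_on with
  | empty => simpa using hy
  | insert a s has ih =>
    rw [Finset.sum_insert has]
    have h0 : 0 ≤ ∑ i ∈ s, u i := Finset.sum_nonneg fun i _ => hu i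
    have hmem : ∑ i ∈ s, u i ∈ disjointComplement (u a) :=
      Submodule.sum_mem _ fun i hi =>
        (mem_disjointComplement_of_nonneg (hu a) (hu i)).2 (hd i a fun h => has (h ▸ hi))
    rw [mem_disjointComplement_of_nonneg (hu a) h0] at hmem
    -- The sum of two disjoint elements is their supremum.
    rw [add_comm, ← inf_add_sup, hmem, zero_add]
    exact sup_le ih (hle a)

end Disjointness

/-! ### Coordinate functionals of atoms -/

section Coordinates

variable {X : Type*} [NormedAddCommGroup X] [Lattice X] [IsOrderedAddMonoid X]
  [HasSolidNorm X] [NormedSpace ℝ X] [IsOrderedModule ℝ X] {a : X}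

theorem coordFunctional_eq (ha : IsLatticeAtom a) (h0 : a ≠ 0) {x : X} {t : ℝ}
    (h : x - t • a ∈ disjointComplement a) : coordFunctional a x = t :=
  (existsUnique_coord ha h0 x).unique (coordFunctional_spec ha h0 x) h

theorem sub_coordFunctional_mem (ha : IsLatticeAtom a) (h0 : a ≠ 0) (x : X) :
    x - coordFunctional a x • a ∈ disjointComplement a :=
  coordFunctional_spec ha h0 x

theorem coordFunctional_add (ha : IsLatticeAtom a) (h0 : a ≠ 0) (x y : X) :
    coordFunctional a (x + y) = coordFunctional a x + coordFunctional a y := by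
  apply coordFunctional_eq ha h0
  convert add_mem (sub_coordFunctional_mem ha h0 x) (sub_coordFunctional_mem ha h0 y) using 1
  module

theorem coordFunctional_smul (ha : IsLatticeAtom a) (h0 : a ≠ 0) (c : ℝ) (x : X) :
    coordFunctional a (c • x) = c * coordFunctional a x := by
  apply coordFunctional_eq ha h0
  convert Submodule.smul_mem _ c (sub_coordFunctional_mem ha h0 x) using 1
  module

theorem coordFunctional_self (ha : IsLatticeAtom a) (h0 : a ≠ 0) : coordFunctional a a = 1 := by
  apply coordFunctional_eq ha h0
  simp

/-- With `t` the coordinate, `|t| • a - |x|` lies below both `|t| • a` and `|x - t • a|`, which are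
disjoint. -/
theorem abs_coordFunctional_smul_le (ha : IsLatticeAtom a) (h0 : a ≠ 0) (x : X) :
    |coordFunctional a x| • a ≤ |x| := by
  set t := coordFunctional a x with ht
  have h1 : |t| • a ∈ disjointComplement (x - t • a) :=
    Submodule.smul_mem _ _ (mem_disjointComplement_comm.1 (sub_coordFunctional_mem ha h0 x))
  have hta : 0 ≤ |t| • a := smul_nonneg (abs_nonneg t) ha.1
  rw [mem_disjointComplement, abs_of_nonneg hta] at h1
  have h2 : |t| • a - |x| ≤ |x - t • a| := by
    have h3 : |t • a| - |x| ≤ |t • a - x| := by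
      have := abs_add_le (t • a - x) x
      rw [sub_add_cancel] at this
      exact sub_le_iff_le_add.2 this
    rwa [abs_smul_real, abs_of_nonneg ha.1, abs_sub_comm] at h3
  have h4 : |t| • a - |x| ≤ |t| • a := sub_le_self _ (abs_nonneg x)
  exact sub_nonpos.1 ((le_inf h4 h2).trans_eq h1)

theorem coordFunctional_nonneg (ha : IsLatticeAtom a) (h0 : a ≠ 0) {x : X} (hx : 0 ≤ x) :
    0 ≤ coordFunctional a x := by
  by_contra! hlt
  set t := coordFunctional a x with ht
  have hle : (-t) • a ≤ x - t • a := by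
    rw [neg_smul, sub_eq_add_neg]
    exact le_add_of_nonneg_left hx
  have hn : 0 ≤ (-t) • a := smul_nonneg (by linarith) ha.1
  have h1 : (-t) • a ∈ disjointComplement a :=
    mem_disjointComplement_of_abs_le (sub_coordFunctional_mem ha h0 x)
      (by rw [abs_of_nonneg hn]; exact hle.trans (le_abs_self _))
  have h2 : a ∈ disjointComplement a := (Submodule.smul_mem_iff _ (by linarith : -t ≠ 0)).1 h1
  exact h0 (eq_zero_of_mem_disjointComplement_self h2)

end Coordinates

/-! ### Monotone convergence and minimal elements in AL-spaces -/

section ALSpace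

variable {X : Type*} [NormedAddCommGroup X] [Lattice X] [IsOrderedAddMonoid X]

theorem IsALSpace.norm_sub (hX : IsALSpace X) {x y : X} (hx : 0 ≤ x) (hxy : x ≤ y) :
    ‖y - x‖ = ‖y‖ - ‖x‖ := by
  have := hX (y - x) x (sub_nonneg.2 hxy) hx
  rw [sub_add_cancel] at this
  linarith

theorem IsALSpace.norm_sum (hX : IsALSpace X) {I : Type*} {u : I → X} (hu : ∀ i, 0 ≤ u i)
    (F : Finset I) : ‖∑ i ∈ F, u i‖ = ∑ i ∈ F, ‖u i‖ := by
  classical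
  induction F using Finset.induction_on with
  | empty => simp
  | insert a s has ih =>
    rw [Finset.sum_insert has, Finset.sum_insert has,
      hX _ _ (hu a) (Finset.sum_nonneg fun i _ => hu i), ih]

variable [HasSolidNorm X]

theorem norm_le_norm_of_nonneg_of_le {x y : X} (hx : 0 ≤ x) (hxy : x ≤ y) : ‖x‖ ≤ ‖y‖ :=
  norm_le_norm_of_abs_le_abs (by rwa [abs_of_nonneg hx, abs_of_nonneg (hx.trans hxy)])

/-- For comparable positive elements the distance is the difference of the norms, so convergence of
the norms makes the sequence Cauchy. -/
theorem IsALSpace.exists_tendsto_of_antitone [CompleteSpace X] (hX : IsALSpace X) {u : ℕ → X}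
    (hu : Antitone u) (h0 : ∀ n, 0 ≤ u n) : ∃ l, Tendsto u atTop (𝓝 l) := by
  have hanti : Antitone fun n => ‖u n‖ := fun m n h => norm_le_norm_of_nonneg_of_le (h0 n) (hu h)
  have hc : CauchySeq fun n => ‖u n‖ :=
    (tendsto_atTop_ciInf hanti ⟨0, by rintro _ ⟨n, rfl⟩; exact norm_nonneg _⟩).cauchySeq
  have hdist : ∀ m n, dist (u m) (u n) ≤ dist ‖u m‖ ‖u n‖ := by
    intro m n
    rcases le_total m n with h | h
    · rw [dist_eq_norm, hX.norm_sub (h0 n) (hu h), Real.dist_eq]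
      exact le_abs_self _
    · rw [dist_comm, dist_eq_norm, hX.norm_sub (h0 m) (hu h), dist_comm, Real.dist_eq]
      exact le_abs_self _
  refine cauchySeq_tendsto_of_complete (Metric.cauchySeq_iff.2 fun ε hε => ?_)
  obtain ⟨N, hN⟩ := Metric.cauchySeq_iff.1 hc ε hε
  exact ⟨N, fun m hm n hn => (hdist m n).trans_lt (hN m hm n hn)⟩

/-- A nonempty closed set of positive elements of an AL-space has a minimal element. -/
theorem IsALSpace.exists_minimal_of_isClosed [CompleteSpace X] (hX : IsALSpace X) {S : Set X}
    (hS : IsClosed S) (h0 : ∀ u ∈ S, 0 ≤ u) {x : X} (hx : x ∈ S) :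
    ∃ u ∈ S, u ≤ x ∧ ∀ v ∈ S, v ≤ u → v = u := by
  -- Greedy descent: below `u`, choose an element of `S` whose norm is within `(1 / 2) ^ n` of the
  -- infimum.
  have step : ∀ (n : ℕ) (u : S), ∃ u' : S, (u' : X) ≤ u ∧
      ∀ v ∈ S, v ≤ (u : X) → ‖(u' : X)‖ ≤ ‖v‖ + (1 / 2) ^ n := by
    intro n u
    have hne : ((fun v : X => ‖v‖) '' {v ∈ S | v ≤ (u : X)}).Nonempty :=
      ⟨_, u, ⟨u.2, le_rfl⟩, rfl⟩
    have hbd : BddBelow ((fun v : X => ‖v‖) '' {v ∈ S | v ≤ (u : X)}) :=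
      ⟨0, by rintro _ ⟨v, -, rfl⟩; exact norm_nonneg v⟩
    obtain ⟨_, ⟨v, ⟨hvS, hvu⟩, rfl⟩, hv⟩ := exists_lt_of_csInf_lt hne
      (lt_add_of_pos_right _ (by positivity : (0 : ℝ) < (1 / 2) ^ n))
    refine ⟨⟨v, hvS⟩, hvu, fun v' hv' hle => hv.le.trans ?_⟩
    gcongr
    exact csInf_le hbd ⟨v', ⟨hv', hle⟩, rfl⟩
  choose next hnext hmin using step
  let u : ℕ → S := fun n => Nat.rec (motive := fun _ => S) ⟨x, hx⟩ next n
  have hanti : Antitone fun n : ℕ => (u n : X) := by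
    refine antitone_nat_of_succ_le (f := fun n : ℕ => (u n : X)) fun n => ?_
    exact hnext n (u n)
  obtain ⟨l, hl⟩ := hX.exists_tendsto_of_antitone hanti fun n => h0 _ (u n).2
  have hle : ∀ n, l ≤ (u n : X) := fun n =>
    le_of_tendsto hl (eventually_atTop.2 ⟨n, fun m hm => hanti hm⟩)
  have hlS : l ∈ S := hS.mem_of_tendsto hl (Eventually.of_forall fun n => (u n).2)
  refine ⟨l, hlS, hle 0, fun v hv hvl => ?_⟩
  -- Any `v ∈ S` below the limit was a competitor at every stage.
  have h1 : ∀ n : ℕ, ‖l‖ - ‖v‖ ≤ (1 / 2) ^ n := by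
    intro n
    have h2 := hmin n (u n) v hv (hvl.trans (hle n))
    have h3 : ‖l‖ ≤ ‖(u (n + 1) : X)‖ := norm_le_norm_of_nonneg_of_le (h0 l hlS) (hle (n + 1))
    have h4 : ‖(u (n + 1) : X)‖ ≤ ‖v‖ + (1 / 2) ^ n := h2
    linarith
  have h5 : ‖l‖ - ‖v‖ ≤ 0 := ge_of_tendsto' (tendsto_pow_atTop_nhds_zero_of_lt_one
    (by norm_num) (by norm_num)) h1
  rw [← hX.norm_sub (h0 v hv) hvl] at h5
  exact (sub_eq_zero.1 (norm_le_zero_iff.1 h5)).symm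

end ALSpace

/-! ### Band projections and a criterion for atoms -/

section BandProjection

variable {X : Type*} [NormedAddCommGroup X] [Lattice X] [IsOrderedAddMonoid X]
  [HasSolidNorm X] [NormedSpace ℝ X] [IsOrderedModule ℝ X] [CompleteSpace X]

/-- The band projection of a positive `x` onto the band spanned by a positive `y`. -/
theorem IsALSpace.exists_bandProjection (hX : IsALSpace X) {x y : X} (hx : 0 ≤ x) (hy : 0 ≤ y) :
    ∃ p, 0 ≤ p ∧ p ≤ x ∧ (x - p) ⊓ y = 0 ∧ ∀ z, y ∈ disjointComplement z →
      p ∈ disjointComplement z := by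
  -- The projection is the limit of the increasing `x ⊓ n • y`, obtained from the decreasing
  -- complements.
  have hmono : Monotone fun n : ℕ => x ⊓ n • y := fun m n h =>
    inf_le_inf_left _ (nsmul_le_nsmul_left hy h)
  obtain ⟨l, hl⟩ := hX.exists_tendsto_of_antitone (u := fun n : ℕ => x - x ⊓ n • y)
    (fun m n h => sub_le_sub_left (hmono h) x) (fun n => sub_nonneg.2 inf_le_left)
  have hp : Tendsto (fun n : ℕ => x ⊓ n • y) atTop (𝓝 (x - l)) := by
    simpa using (tendsto_const_nhds (x := x)).sub hl
  set p := x - l with hpl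
  have hn : ∀ n : ℕ, 0 ≤ x ⊓ n • y := fun n => le_inf hx (nsmul_nonneg hy n)
  refine ⟨p, ge_of_tendsto' hp hn, le_of_tendsto' hp fun n => inf_le_left, ?_, fun z hz => ?_⟩
  -- Shifting the index shows `x ⊓ (p + y) = p`, which is the disjointness translated by `p`.
  · have h1 : Tendsto (fun n : ℕ => x ⊓ (x ⊓ n • y + y)) atTop (𝓝 (x ⊓ (p + y))) := by
      have hc : Continuous fun z : X => x ⊓ (z + y) := by fun_prop
      exact (hc.tendsto p).comp hp
    have h2 : (fun n : ℕ => x ⊓ (x ⊓ n • y + y)) = fun n : ℕ => x ⊓ (n + 1) • y := by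
      funext n
      rw [inf_add, ← inf_assoc, inf_eq_left.2 (le_add_of_nonneg_right hy), succ_nsmul]
    rw [h2] at h1
    have h3 : x ⊓ (p + y) = p :=
      tendsto_nhds_unique h1 ((tendsto_add_atTop_iff_nat (f := fun n : ℕ => x ⊓ n • y) 1).2 hp)
    have h4 : (x - p) ⊓ y = x ⊓ (p + y) - p := by
      rw [sub_eq_add_neg (x ⊓ _), inf_add]; congr 1 <;> abel
    rw [h4, h3, sub_self]
  · refine (isClosed_disjointComplement z).mem_of_tendsto hp (Eventually.of_forall fun n => ?_)
    refine mem_disjointComplement_of_abs_le (y := n • y) (nsmul_mem hz n) ?_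
    rw [abs_of_nonneg (hn n), abs_of_nonneg (nsmul_nonneg hy n)]
    exact inf_le_right

/-- In an AL-space, a positive element without nontrivial components is an atom. -/
theorem IsALSpace.isLatticeAtom_of_components (hX : IsALSpace X) {u : X} (hu : 0 ≤ u)
    (h : ∀ p, 0 ≤ p → p ≤ u → (u - p) ⊓ p = 0 → p = 0 ∨ p = u) : IsLatticeAtom u := by
  refine ⟨hu, fun y hy hyu => ?_⟩
  -- The projection of `u` onto the band of `(y - s • u)⁺` is a component of `u`, hence `0` or `u`;
  -- the two cases decide the sign of `y - s • u`.
  have dich : ∀ s : ℝ, 0 ≤ s → y ≤ s • u ∨ s • u ≤ y := by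
    intro s hs
    set v := y - s • u with hv
    obtain ⟨p, hp0, hpu, hpd, hpz⟩ := hX.exists_bandProjection hu (posPart_nonneg v)
    have hup : 0 ≤ u - p := sub_nonneg.2 hpu
    have hvle : v⁺ ≤ u := by
      refine sup_le ?_ hu
      exact (sub_le_self _ (smul_nonneg hs hu)).trans hyu
    have hd : (u - p) ⊓ p = 0 := by
      have h1 : v⁺ ∈ disjointComplement (u - p) := by
        rw [mem_disjointComplement_of_nonneg hup (posPart_nonneg v), inf_comm]; exact hpd
      have h2 := hpz _ h1
      rwa [mem_disjointComplement_of_nonneg hup hp0, inf_comm] at h2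
    rcases h p hp0 hpu hd with h3 | h3
    · left
      rw [h3, sub_zero] at hpd
      have h4 : v⁺ = 0 := eq_zero_of_inf_eq_zero_of_le (posPart_nonneg v) hvle le_rfl hpd
      exact sub_nonpos.1 (posPart_eq_zero.1 h4)
    · right
      have h4 : v⁺ ∈ disjointComplement v⁻ := by
        rw [mem_disjointComplement_of_nonneg (negPart_nonneg v) (posPart_nonneg v)]
        exact posPart_inf_negPart_eq_zero v
      have h5 := hpz _ h4
      rw [h3] at h5
      have h6 : v⁻ ≤ s • u := by
        refine sup_le ?_ (smul_nonneg hs hu)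
        rw [hv, neg_sub]
        exact sub_le_self _ hy
      have h7 : v⁻ ∈ disjointComplement v⁻ :=
        mem_disjointComplement_of_abs_le (Submodule.smul_mem _ s h5) (by
          rwa [abs_of_nonneg (negPart_nonneg v), abs_of_nonneg (smul_nonneg hs hu)])
      exact sub_nonneg.1 (negPart_eq_zero.1 (eq_zero_of_mem_disjointComplement_self h7))
  have hne : {s : ℝ | 0 ≤ s ∧ y ≤ s • u}.Nonempty := ⟨1, zero_le_one, by simpa using hyu⟩
  have hbd : BddBelow {s : ℝ | 0 ≤ s ∧ y ≤ s • u} := ⟨0, fun s hs => hs.1⟩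
  have hcl : IsClosed {s : ℝ | 0 ≤ s ∧ y ≤ s • u} :=
    isClosed_Ici.inter (isClosed_le continuous_const (by fun_prop : Continuous fun s : ℝ => s • u))
  obtain ⟨ht0, ht⟩ := hcl.csInf_mem hne hbd
  set t := sInf {s : ℝ | 0 ≤ s ∧ y ≤ s • u} with htdef
  refine ⟨t, le_antisymm ht ?_⟩
  rcases ht0.eq_or_lt with h0 | h0
  · rw [← h0, zero_smul]; exact hy
  have hlt : ∀ s ∈ Set.Ioo 0 t, s • u ≤ y := fun s hs =>
    (dich s hs.1.le).resolve_left fun hle => (csInf_le hbd ⟨hs.1.le, hle⟩).not_gt hs.2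
  have hcl' : IsClosed {s : ℝ | s • u ≤ y} := isClosed_le (by fun_prop) continuous_const
  have hmem : t ∈ closure (Set.Ioo 0 t) := by
    rw [closure_Ioo h0.ne]; exact ⟨h0.le, le_rfl⟩
  exact hcl'.closure_subset_iff.2 hlt hmem

end BandProjection

/-! ### Disjointness and boundedness for f-algebra products -/

namespace IsFAlgebraProduct

section Algebra

variable {X : Type*} [AddCommGroup X] [Lattice X] [Module ℝ X] {P : X → X → X}

/-- An f-algebra product as a bilinear map. -/
noncomputable def toBilin (hP : IsFAlgebraProduct P) : X →ₗ[ℝ] X →ₗ[ℝ] X :=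
  LinearMap.mk₂ ℝ P hP.add_left hP.smul_left hP.add_right hP.smul_right

theorem toBilin_apply (hP : IsFAlgebraProduct P) (f g : X) : hP.toBilin f g = P f g := rfl

theorem sub_left (hP : IsFAlgebraProduct P) (f g h : X) : P (f - g) h = P f h - P g h :=
  LinearMap.map_sub₂ hP.toBilin f g h

theorem sub_right (hP : IsFAlgebraProduct P) (f g h : X) : P f (g - h) = P f g - P f h :=
  map_sub (hP.toBilin f) g h

theorem zero_left (hP : IsFAlgebraProduct P) (g : X) : P 0 g = 0 :=
  LinearMap.map_zero₂ hP.toBilin g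

theorem zero_right (hP : IsFAlgebraProduct P) (f : X) : P f 0 = 0 :=
  map_zero (hP.toBilin f)

variable [IsOrderedAddMonoid X]

theorem mono (hP : IsFAlgebraProduct P) {f f' g g' : X} (hf : 0 ≤ f) (hff : f ≤ f') (hg : 0 ≤ g)
    (hgg : g ≤ g') : P f g ≤ P f' g' := by
  have h1 := hP.nonneg (f' - f) g (sub_nonneg.2 hff) hg
  have h2 := hP.nonneg f' (g' - g) (hf.trans hff) (sub_nonneg.2 hgg)
  rw [hP.sub_left, sub_nonneg] at h1
  rw [hP.sub_right, sub_nonneg] at h2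
  exact h1.trans h2

variable [IsOrderedModule ℝ X]

/-- Expanding `(|f| - f)(|g| + g) + (|f| + f)(|g| - g) ≥ 0` gives `2(|f||g| - fg) ≥ 0`; matching the
signs instead gives the bound for `-fg`. -/
theorem abs_le (hP : IsFAlgebraProduct P) (f g : X) : |P f g| ≤ P |f| |g| := by
  have half : ∀ x : X, 0 ≤ (2 : ℝ) • x → 0 ≤ x := fun x hx => by
    simpa using smul_nonneg (by norm_num : (0 : ℝ) ≤ 2⁻¹) hx
  have hf := sub_nonneg.2 (le_abs_self f)
  have hg := sub_nonneg.2 (le_abs_self g)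
  have hg' : 0 ≤ |g| + g := by simpa using sub_nonneg.2 (neg_le_abs g)
  have hf'' : 0 ≤ |f| + f := by simpa using sub_nonneg.2 (neg_le_abs f)
  have h1 := add_nonneg (hP.nonneg _ _ hf hg') (hP.nonneg _ _ hf'' hg)
  have h2 := add_nonneg (hP.nonneg _ _ hf'' hg') (hP.nonneg _ _ hf hg)
  simp only [hP.sub_left, hP.sub_right, hP.add_left, hP.add_right] at h1 h2
  refine abs_le'.2 ⟨sub_nonneg.1 (half _ ?_), ?_⟩
  · convert h1 using 1; module
  · rw [neg_le_iff_add_nonneg]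
    refine half _ ?_
    convert h2 using 1; module

end Algebra

variable {X : Type*} [NormedAddCommGroup X] [Lattice X] [IsOrderedAddMonoid X]
  [HasSolidNorm X] [NormedSpace ℝ X] [IsOrderedModule ℝ X] {P : X → X → X}

/-- Two uses of the disjointness axiom: `|x||y|` is disjoint from `|x|`, and therefore from `|x||y|`
itself. -/
theorem mul_eq_zero_of_disjoint (hP : IsFAlgebraProduct P) {x y : X}
    (h : x ∈ disjointComplement y) : P x y = 0 := by
  have hd : |x| ⊓ |y| = 0 := h
  have h1 := (hP.inf_eq_zero |y| |x| |x| (by rwa [inf_comm]) (abs_nonneg x)).1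
  have h2 := (hP.inf_eq_zero |x| (P |x| |y|) |y| (by rwa [inf_comm]) (abs_nonneg y)).2
  rw [inf_idem] at h2
  have h3 : |P x y| = 0 := le_antisymm (h2 ▸ hP.abs_le x y) (abs_nonneg _)
  rw [← norm_eq_zero, ← norm_abs_eq_norm, h3, norm_zero]

theorem norm_le_norm_abs (hP : IsFAlgebraProduct P) (f g : X) : ‖P f g‖ ≤ ‖P |f| |g|‖ := by
  rw [← norm_abs_eq_norm (P f g)]
  exact norm_le_norm_of_nonneg_of_le (abs_nonneg _) (hP.abs_le f g)

theorem norm_smul_smul (hP : IsFAlgebraProduct P) (r s : ℝ) (f g : X) :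
    ‖P (r • f) (s • g)‖ = |r| * |s| * ‖P f g‖ := by
  rw [hP.smul_left, hP.smul_right, norm_smul, norm_smul, Real.norm_eq_abs, Real.norm_eq_abs,
    mul_assoc]

/-- Every f-algebra product on a Banach lattice is bounded. -/
theorem exists_bound [CompleteSpace X] (hP : IsFAlgebraProduct P) :
    ∃ K : ℝ, 0 ≤ K ∧ ∀ f g, ‖P f g‖ ≤ K * ‖f‖ * ‖g‖ := by
  by_contra! hcon
  -- Both factors will be normalised to norm `2⁻ⁿ`; the `4 ^ n` absorbs this and leaves `n`.
  have h1 : ∀ n : ℕ, ∃ f g, (4 ^ n * n : ℝ) * ‖f‖ * ‖g‖ < ‖P f g‖ := fun n =>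
    hcon _ (by positivity)
  choose f g hfg using h1
  have hf : ∀ n, 0 < ‖f n‖ := fun n => by
    rw [norm_pos_iff]
    intro h
    have := hfg n
    simp [h, hP.zero_left] at this
  have hg : ∀ n, 0 < ‖g n‖ := fun n => by
    rw [norm_pos_iff]
    intro h
    have := hfg n
    simp [h, hP.zero_right] at this
  -- A single sum dominates all the rescaled terms, so `‖P F G‖` will exceed every `n`.
  have key : ∀ f : ℕ → X, (∀ n, 0 < ‖f n‖) →
      ∃ F : X, ∀ n, ((1 / 2) ^ n / ‖f n‖) • |f n| ≤ F := by
    intro f hf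
    have hs : Summable fun n => ((1 / 2) ^ n / ‖f n‖ : ℝ) • |f n| := by
      refine Summable.of_norm_bounded summable_geometric_two fun n => ?_
      rw [norm_smul, norm_abs_eq_norm, Real.norm_of_nonneg (by positivity),
        div_mul_cancel₀ _ (hf n).ne']
    exact ⟨_, fun n => hs.le_tsum n fun m _ =>
      smul_nonneg (div_nonneg (by positivity) (norm_nonneg _)) (abs_nonneg _)⟩
  obtain ⟨F, hF⟩ := key f hf
  obtain ⟨G, hG⟩ := key g hg
  have h2 : ∀ n : ℕ, (n : ℝ) ≤ ‖P F G‖ := by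
    intro n
    have ha : (0 : ℝ) ≤ (1 / 2) ^ n / ‖f n‖ := by positivity
    have hb : (0 : ℝ) ≤ (1 / 2) ^ n / ‖g n‖ := by positivity
    have hfa := smul_nonneg ha (abs_nonneg (f n))
    have hgb := smul_nonneg hb (abs_nonneg (g n))
    have h3 := norm_le_norm_of_nonneg_of_le (hP.nonneg _ _ hfa hgb) (hP.mono hfa (hF n) hgb (hG n))
    rw [hP.norm_smul_smul, abs_of_nonneg ha, abs_of_nonneg hb] at h3
    refine le_trans ?_ h3
    have h4 := (hfg n).le.trans (hP.norm_le_norm_abs (f n) (g n))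
    have hf0 := (hf n).ne'
    have hg0 := (hg n).ne'
    calc (n : ℝ) = (1 / 2) ^ n / ‖f n‖ * ((1 / 2) ^ n / ‖g n‖) *
          ((4 ^ n * n : ℝ) * ‖f n‖ * ‖g n‖) := by
          have h5 : ((1 / 2 : ℝ)) ^ n * (1 / 2) ^ n * 4 ^ n = 1 := by
            rw [← mul_pow, ← mul_pow]; norm_num
          field_simp at h5 ⊢
          linear_combination (-(n : ℝ)) * h5
      _ ≤ _ := by gcongr
  obtain ⟨n, hn⟩ := exists_nat_gt ‖P F G‖
  exact hn.not_ge (h2 n)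

theorem continuous_right [CompleteSpace X] (hP : IsFAlgebraProduct P) (f : X) :
    Continuous (P f) := by
  obtain ⟨K, -, hK⟩ := hP.exists_bound
  exact AddMonoidHomClass.continuous_of_bound (hP.toBilin f) (K * ‖f‖) (hK f)

theorem continuous_left [CompleteSpace X] (hP : IsFAlgebraProduct P) (g : X) :
    Continuous fun f => P f g := by
  obtain ⟨K, -, hK⟩ := hP.exists_bound
  exact AddMonoidHomClass.continuous_of_bound (hP.toBilin.flip g) (K * ‖g‖) fun f =>
    (hK f g).trans_eq (by ring)

theorem continuous_uncurry [CompleteSpace X] (hP : IsFAlgebraProduct P) :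
    Continuous fun z : X × X => P z.1 z.2 := by
  obtain ⟨K, -, hK⟩ := hP.exists_bound
  exact (hP.toBilin.mkContinuous₂ K hK).continuous₂

end IsFAlgebraProduct

/-! ### Maximal atom families and the atomic part -/

section AtomFamily

variable {X I : Type*} [NormedAddCommGroup X] [Lattice X] [NormedSpace ℝ X] {e : I → X}

namespace IsMaximalAtomFamily

theorem isLatticeAtom (he : IsMaximalAtomFamily e) (i : I) : IsLatticeAtom (e i) :=
  (he.maximal.prop _ ⟨i, rfl⟩).1

theorem norm_eq_one (he : IsMaximalAtomFamily e) (i : I) : ‖e i‖ = 1 :=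
  (he.maximal.prop _ ⟨i, rfl⟩).2

theorem nonneg (he : IsMaximalAtomFamily e) (i : I) : 0 ≤ e i := (he.isLatticeAtom i).1

theorem ne_zero (he : IsMaximalAtomFamily e) (i : I) : e i ≠ 0 := by
  rw [← norm_ne_zero_iff, he.norm_eq_one]; exact one_ne_zero

variable [IsOrderedAddMonoid X] [HasSolidNorm X] [IsOrderedModule ℝ X]

/-- Maximality enters here: the normalised atom can be inserted into the family, so it already
belongs to it. -/
theorem exists_eq_smul (he : IsMaximalAtomFamily e) {u : X} (hu : IsLatticeAtom u) (h0 : u ≠ 0) :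
    ∃ i, e i = ‖u‖⁻¹ • u := by
  have hpos : 0 < ‖u‖ := norm_pos_iff.2 h0
  refine he.maximal.mem_of_prop_insert ?_
  rintro a (rfl | ha)
  · refine ⟨⟨smul_nonneg (by positivity) hu.1, fun x hx hxu => ?_⟩, ?_⟩
    · rw [le_inv_smul_iff_of_pos hpos] at hxu
      obtain ⟨c, hc⟩ := hu.2 _ (smul_nonneg hpos.le hx) hxu
      refine ⟨c, ?_⟩
      rw [smul_comm, ← hc, inv_smul_smul₀ hpos.ne']
    · rw [norm_smul, norm_inv, norm_norm, inv_mul_cancel₀ hpos.ne']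
  · exact he.maximal.prop a ha

/-- The meet is a multiple of both atoms, with equal coefficients because the norms are one; a
nonzero coefficient would make the atoms equal. -/
theorem disjoint (he : IsMaximalAtomFamily e) {i j : I} (hij : i ≠ j) :
    e i ∈ disjointComplement (e j) := by
  rw [mem_disjointComplement_of_nonneg (he.nonneg j) (he.nonneg i)]
  by_contra hne
  have h0 : 0 ≤ e i ⊓ e j := le_inf (he.nonneg i) (he.nonneg j)
  obtain ⟨c, hc⟩ := (he.isLatticeAtom i).2 _ h0 inf_le_left
  obtain ⟨d, hd⟩ := (he.isLatticeAtom j).2 _ h0 inf_le_right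
  have hnorm : |c| = |d| := by
    have h1 : ‖c • e i‖ = ‖d • e j‖ := by rw [← hc, ← hd]
    simpa [norm_smul, he.norm_eq_one] using h1
  have hcd : ∀ (t : ℝ) (k : I), e i ⊓ e j = t • e k → t = |t| := by
    intro t k ht
    by_contra hlt
    have ht0 : t ≤ 0 := le_of_lt (not_le.1 fun h => hlt (abs_of_nonneg h).symm)
    exact hne (le_antisymm (ht ▸ smul_nonpos_of_nonpos_of_nonneg ht0 (he.nonneg k)) h0)
  have hcd' : c = d := by rw [hcd c i hc, hcd d j hd, hnorm]
  have hc0 : c ≠ 0 := fun h => hne (by rw [hc, h, zero_smul])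
  rw [hc, ← hcd'] at hd
  exact hij (he.injective (smul_right_injective X hc0 hd))

variable (hX : IsALSpace X)
include hX

/-- The terms `|eᵢ*(f)| eᵢ` are disjoint and below `|f|`, hence so is their sum, whose norm is the
sum of the norms. -/
theorem sum_abs_coordFunctional_le (he : IsMaximalAtomFamily e) (f : X) (F : Finset I) :
    ∑ i ∈ F, |coordFunctional (e i) f| ≤ ‖f‖ := by
  have hn : ∀ i, 0 ≤ |coordFunctional (e i) f| • e i := fun i =>
    smul_nonneg (abs_nonneg _) (he.nonneg i)
  have h1 : ∑ i ∈ F, |coordFunctional (e i) f| • e i ≤ |f| := by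
    refine sum_le_of_pairwise_disjoint hn (fun i j hij => ?_) (abs_nonneg f)
      (fun i => abs_coordFunctional_smul_le (he.isLatticeAtom i) (he.ne_zero i) f) F
    have h2 := he.disjoint hij
    rw [mem_disjointComplement_of_nonneg (he.nonneg j) (he.nonneg i)] at h2
    have h3 := smul_inf_eq_zero h2 (abs_nonneg (coordFunctional (e i) f))
    rw [inf_comm] at h3 ⊢
    exact smul_inf_eq_zero h3 (abs_nonneg _)
  have h2 := norm_le_norm_of_nonneg_of_le (Finset.sum_nonneg fun i _ => hn i) h1
  rw [hX.norm_sum hn, norm_abs_eq_norm] at h2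
  simpa [norm_smul, he.norm_eq_one] using h2

theorem summable_abs_coordFunctional (he : IsMaximalAtomFamily e) (f : X) :
    Summable fun i => |coordFunctional (e i) f| :=
  summable_of_sum_le (fun _ => abs_nonneg _) (he.sum_abs_coordFunctional_le hX f)

theorem tsum_abs_coordFunctional_le (he : IsMaximalAtomFamily e) (f : X) :
    ∑' i, |coordFunctional (e i) f| ≤ ‖f‖ :=
  Real.tsum_le_of_sum_le (fun _ => abs_nonneg _) (he.sum_abs_coordFunctional_le hX f)

theorem abs_coordFunctional_le (he : IsMaximalAtomFamily e) (f : X) (i : I) :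
    |coordFunctional (e i) f| ≤ ‖f‖ := by
  simpa using he.sum_abs_coordFunctional_le hX f {i}

omit hX in
theorem sub_coord_smul_mem_of_hasSum (he : IsMaximalAtomFamily e) {c : I → ℝ} {s : X}
    (hs : HasSum (fun i => c i • e i) s) (j : I) : s - c j • e j ∈ disjointComplement (e j) := by
  have h1 : Tendsto (fun F : Finset I => ∑ i ∈ F, c i • e i - c j • e j) atTop
      (𝓝 (s - c j • e j)) := Tendsto.sub_const hs _
  refine (isClosed_disjointComplement (e j)).mem_of_tendsto h1 ?_
  classical
  filter_upwards [eventually_ge_atTop ({j} : Finset I)] with F hF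
  have hj : j ∈ F := hF (Finset.mem_singleton_self j)
  rw [← Finset.add_sum_erase F _ hj, add_sub_cancel_left]
  exact Submodule.sum_mem _ fun i hi =>
    Submodule.smul_mem _ _ (he.disjoint (Finset.ne_of_mem_erase hi))

omit hX in
theorem coordFunctional_of_hasSum (he : IsMaximalAtomFamily e) {c : I → ℝ} {s : X}
    (hs : HasSum (fun i => c i • e i) s) (j : I) : coordFunctional (e j) s = c j :=
  coordFunctional_eq (he.isLatticeAtom j) (he.ne_zero j) (he.sub_coord_smul_mem_of_hasSum hs j)

/-- The band decomposition into an atomic and a diffuse part. -/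
theorem exists_atomic_part [CompleteSpace X] (he : IsMaximalAtomFamily e) (f : X) :
    ∃ s, HasSum (fun i => coordFunctional (e i) f • e i) s ∧
      ∀ j, f - s ∈ disjointComplement (e j) := by
  have hs : Summable fun i => coordFunctional (e i) f • e i :=
    Summable.of_norm_bounded (he.summable_abs_coordFunctional hX f) fun i => by
      rw [norm_smul, he.norm_eq_one, mul_one, Real.norm_eq_abs]
  refine ⟨_, hs.hasSum, fun j => ?_⟩
  convert sub_mem (sub_coordFunctional_mem (he.isLatticeAtom j) (he.ne_zero j) f)
    (he.sub_coord_smul_mem_of_hasSum hs.hasSum j) using 1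
  abel

end IsMaximalAtomFamily

end AtomFamily

/-! ### Every f-algebra product is weighted -/

section Main

variable {X I : Type*} [NormedAddCommGroup X] [Lattice X] [IsOrderedAddMonoid X]
  [HasSolidNorm X] [NormedSpace ℝ X] [IsOrderedModule ℝ X] [CompleteSpace X] {e : I → X}
  {P : X → X → X}

namespace IsFAlgebraProduct

theorem mul_self_eq_zero_of_diffuse (hX : IsALSpace X) (hP : IsFAlgebraProduct P)
    (he : IsMaximalAtomFamily e) {x : X} (hx : 0 ≤ x) (hd : ∀ i, x ∈ disjointComplement (e i)) :
    P x x = 0 := by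
  by_contra hne
  obtain ⟨K, hK0, hK⟩ := hP.exists_bound
  have hx0 : 0 < ‖x‖ := norm_pos_iff.2 fun h => hne (by rw [h, hP.zero_left])
  have hPx : 0 < ‖P x x‖ := norm_pos_iff.2 hne
  obtain ⟨δ, hδ⟩ : ∃ δ, δ = ‖P x x‖ / ‖x‖ := ⟨_, rfl⟩
  have hδ0 : 0 < δ := hδ ▸ div_pos hPx hx0
  have bound : ∀ u : X, u ≠ 0 → δ * ‖u‖ ≤ ‖P u u‖ → δ ≤ K * ‖u‖ := fun u hu h =>
    le_of_mul_le_mul_right (h.trans (hK u u)) (norm_pos_iff.2 hu)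
  have hcont : Continuous fun u => ‖P u u‖ :=
    (hP.continuous_uncurry.comp (continuous_id.prodMk continuous_id)).norm
  -- The third condition follows from the second for `u ≠ 0`; it excludes zero while keeping the set
  -- closed.
  have hclosed : IsClosed {u : X | 0 ≤ u ∧ δ * ‖u‖ ≤ ‖P u u‖ ∧ δ ≤ K * ‖u‖} :=
    (isClosed_le continuous_const continuous_id).inter
      ((isClosed_le (continuous_const.mul continuous_norm) hcont).inter
        (isClosed_le continuous_const (continuous_const.mul continuous_norm)))
  have hxS : δ * ‖x‖ ≤ ‖P x x‖ := by rw [hδ, div_mul_cancel₀ _ hx0.ne']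
  obtain ⟨u, ⟨hu, hu1, hu2⟩, hux, hmin⟩ := hX.exists_minimal_of_isClosed hclosed
    (fun u hu => hu.1) ⟨hx, hxS, bound x (norm_pos_iff.1 hx0) hxS⟩
  have hu0 : u ≠ 0 := by
    rintro rfl
    simp only [norm_zero, mul_zero] at hu2
    exact hδ0.not_ge hu2
  have hatom : IsLatticeAtom u := by
    refine hX.isLatticeAtom_of_components hu fun p hp hpu hdis => ?_
    have hq : 0 ≤ u - p := sub_nonneg.2 hpu
    have large : ∀ v : X, 0 ≤ v → v ≤ u → δ * ‖v‖ ≤ ‖P v v‖ → v = 0 ∨ v = u := by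
      intro v hv hvu hle
      by_cases hv0 : v = 0
      · exact Or.inl hv0
      · exact Or.inr (hmin v ⟨hv, hle, bound v hv0 hle⟩ hvu)
    have hmem : u - p ∈ disjointComplement p := (mem_disjointComplement_of_nonneg hp hq).2 hdis
    have hsplit : P u u = P (u - p) (u - p) + P p p := by
      have h1 := hP.mul_eq_zero_of_disjoint hmem
      have h2 := hP.mul_eq_zero_of_disjoint (mem_disjointComplement_comm.1 hmem)
      rw [hP.sub_left, sub_eq_zero] at h1
      rw [hP.sub_right, sub_eq_zero] at h2
      simp only [hP.sub_left, hP.sub_right, h1, h2]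
      abel
    have hnorm : ‖u‖ = ‖u - p‖ + ‖p‖ := by rw [hX.norm_sub hp hpu]; ring
    rw [hsplit, hX _ _ (hP.nonneg _ _ hq hq) (hP.nonneg _ _ hp hp), hnorm] at hu1
    -- The inequality for `u` is the sum of those for `p` and `u - p`, so at least one of these
    -- holds.
    rcases le_total (δ * ‖p‖) ‖P p p‖ with h | h
    · exact large p hp hpu h
    · rcases large (u - p) hq (sub_le_self _ hp) (by linarith) with h | h
      · exact Or.inr (sub_eq_zero.1 h).symm
      · exact Or.inl (by simpa using h)
  obtain ⟨i, hi⟩ := he.exists_eq_smul hatom hu0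
  have h1 := mem_disjointComplement_comm.1 (hd i)
  rw [hi, Submodule.smul_mem_iff _ (inv_ne_zero (norm_ne_zero_iff.2 hu0)),
    mem_disjointComplement_of_nonneg hx hu, inf_eq_left.2 hux] at h1
  exact hu0 h1

/-- For diffuse `y`, `|x||y|` is below the square of the diffuse `|x| + |y|`; the atomic part of `g`
is killed term by term. -/
theorem mul_eq_zero_of_diffuse (hX : IsALSpace X) (hP : IsFAlgebraProduct P)
    (he : IsMaximalAtomFamily e) {x : X} (hd : ∀ i, x ∈ disjointComplement (e i)) (g : X) :
    P x g = 0 := by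
  have key : ∀ y : X, (∀ i, y ∈ disjointComplement (e i)) → P x y = 0 := by
    intro y hy
    have h1 := hP.mul_self_eq_zero_of_diffuse hX he (x := |x| + |y|)
      (add_nonneg (abs_nonneg x) (abs_nonneg y)) fun i =>
        add_mem (mem_disjointComplement_of_abs_le (hd i) (abs_abs x).le)
          (mem_disjointComplement_of_abs_le (hy i) (abs_abs y).le)
    have h2 : P |x| |y| ≤ 0 := h1 ▸ hP.mono (abs_nonneg x)
      (le_add_of_nonneg_right (abs_nonneg y)) (abs_nonneg y) (le_add_of_nonneg_left (abs_nonneg x))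
    rw [← norm_le_zero_iff]
    refine (hP.norm_le_norm_abs x y).trans_eq ?_
    rw [le_antisymm h2 (hP.nonneg _ _ (abs_nonneg x) (abs_nonneg y)), norm_zero]
  obtain ⟨s, hs, hgs⟩ := he.exists_atomic_part hX g
  have h1 := hs.map (hP.toBilin x) (hP.continuous_right x)
  have h2 : (hP.toBilin x ∘ fun i => coordFunctional (e i) g • e i) = fun _ => 0 := by
    funext i
    simp only [Function.comp_apply, map_smul, toBilin_apply,
      hP.mul_eq_zero_of_disjoint (hd i), smul_zero]
  rw [h2] at h1
  have h3 : P x s = 0 := h1.unique hasSum_zero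
  have h4 := key _ hgs
  rwa [hP.sub_right, h3, sub_zero] at h4

/-- The remainder `P a a - t • a` is disjoint from `a`, hence from `P a a`; it also lies below `P a
a`, so it vanishes. -/
theorem atom_mul_self (hP : IsFAlgebraProduct P) {a : X} (ha : IsLatticeAtom a) (h0 : a ≠ 0) :
    P a a = coordFunctional a (P a a) • a := by
  obtain ⟨t, ht, htd⟩ := exists_coord_of_nonneg ha h0 (hP.nonneg a a ha.1 ha.1)
  have htc : coordFunctional a (P a a) = t := coordFunctional_eq ha h0
    ((mem_disjointComplement_of_nonneg ha.1 ht).2 htd)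
  have ht0 : 0 ≤ t := htc ▸ coordFunctional_nonneg ha h0 (hP.nonneg a a ha.1 ha.1)
  have h1 := (hP.inf_eq_zero a (P a a - t • a) a (by rwa [inf_comm]) ha.1).1
  rw [inf_eq_right.2 (sub_le_self _ (smul_nonneg ht0 ha.1)), sub_eq_zero] at h1
  rw [htc]
  exact h1

theorem hasSum (hX : IsALSpace X) (hP : IsFAlgebraProduct P) (he : IsMaximalAtomFamily e)
    (f g : X) : HasSum (fun i => (coordFunctional (e i) (P (e i) (e i)) * coordFunctional (e i) f *
      coordFunctional (e i) g) • e i) (P f g) := by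
  obtain ⟨s, hs, hfs⟩ := he.exists_atomic_part hX f
  have h1 := hP.mul_eq_zero_of_diffuse hX he hfs g
  rw [hP.sub_left, sub_eq_zero] at h1
  rw [h1]
  have h2 : HasSum _ (P s g) := hs.map (hP.toBilin.flip g) (hP.continuous_left g)
  convert h2 using 1
  funext i
  -- Against `e i`, only the component of `g` along `e i` contributes.
  have h3 := hP.mul_eq_zero_of_disjoint (mem_disjointComplement_comm.1
    (sub_coordFunctional_mem (he.isLatticeAtom i) (he.ne_zero i) g))
  rw [hP.sub_right, hP.smul_right, sub_eq_zero,
    hP.atom_mul_self (he.isLatticeAtom i) (he.ne_zero i)] at h3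
  simp only [Function.comp_apply, map_smul, LinearMap.flip_apply, toBilin_apply, h3, smul_smul]
  congr 1
  ring

theorem exists_weight (hX : IsALSpace X) (hP : IsFAlgebraProduct P) (he : IsMaximalAtomFamily e) :
    ∃ w : lp (fun _ : I => ℝ) ⊤, (∀ i, 0 ≤ w i) ∧ IsWeightedProduct e w P := by
  obtain ⟨K, -, hK⟩ := hP.exists_bound
  have hmem : Memℓp (fun i => coordFunctional (e i) (P (e i) (e i))) ⊤ := by
    refine memℓp_infty ⟨K, ?_⟩
    rintro _ ⟨i, rfl⟩
    have h1 := hK (e i) (e i)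
    rw [he.norm_eq_one, mul_one, mul_one] at h1
    exact (he.abs_coordFunctional_le hX _ i).trans h1
  exact ⟨⟨_, hmem⟩, fun i => coordFunctional_nonneg (he.isLatticeAtom i) (he.ne_zero i)
    (hP.nonneg _ _ (he.nonneg i) (he.nonneg i)), hP.hasSum hX he⟩

end IsFAlgebraProduct

/-! ### Weighted products: algebra, convergence and norm -/

namespace IsWeightedProduct

variable {w : lp (fun _ : I => ℝ) ⊤}

theorem isFAlgebraProduct (he : IsMaximalAtomFamily e) (hw : ∀ i, 0 ≤ w i)
    (hP : IsWeightedProduct e w P) : IsFAlgebraProduct P := by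
  have hadd := fun i => coordFunctional_add (he.isLatticeAtom i) (he.ne_zero i)
  have hsmul := fun i => coordFunctional_smul (he.isLatticeAtom i) (he.ne_zero i)
  have hcoord : ∀ f g i, coordFunctional (e i) (P f g) =
      w i * coordFunctional (e i) f * coordFunctional (e i) g := fun f g i =>
    he.coordFunctional_of_hasSum (hP f g) i
  have hnonneg : ∀ f : X, 0 ≤ f → ∀ i, 0 ≤ coordFunctional (e i) f := fun f hf i =>
    coordFunctional_nonneg (he.isLatticeAtom i) (he.ne_zero i) hf
  have hpos : ∀ f g, 0 ≤ f → 0 ≤ g → 0 ≤ P f g := fun f g hf hg =>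
    (hP f g).nonneg fun i => smul_nonneg
      (mul_nonneg (mul_nonneg (hw i) (hnonneg f hf i)) (hnonneg g hg i)) (he.nonneg i)
  have hcomm : ∀ f g, P f g = P g f := fun f g => by
    refine (hP f g).unique ?_
    convert hP g f using 3
    ring
  have hdis : ∀ a b c, a ⊓ b = 0 → 0 ≤ c → P c a ⊓ b = 0 := by
    intro a b c hab hc
    have ha : 0 ≤ a := hab ▸ inf_le_left
    have hb : 0 ≤ b := hab ▸ inf_le_right
    rw [← mem_disjointComplement_of_nonneg hb (hpos c a hc ha)]
    refine (isClosed_disjointComplement b).mem_of_tendsto (hP c a) (Eventually.of_forall fun F =>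
      Submodule.sum_mem _ fun i _ => ?_)
    -- Each term is a multiple of `eᵢ*(a) eᵢ`, which is dominated by `|a|` and so disjoint from `b`.
    rw [mul_smul]
    refine Submodule.smul_mem _ _ (mem_disjointComplement_of_abs_le
      ((mem_disjointComplement_of_nonneg hb ha).2 hab) ?_)
    rw [abs_smul_real, abs_of_nonneg (he.nonneg i)]
    exact abs_coordFunctional_smul_le (he.isLatticeAtom i) (he.ne_zero i) a
  have haddl : ∀ f g h, P (f + g) h = P f h + P g h := fun f g h => by
    refine (hP (f + g) h).unique ?_
    convert (hP f h).add (hP g h) using 2 with i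
    rw [hadd]
    module
  have hsmull : ∀ (r : ℝ) f g, P (r • f) g = r • P f g := fun r f g => by
    refine (hP (r • f) g).unique ?_
    convert (hP f g).const_smul r using 2 with i
    rw [hsmul]
    module
  refine ⟨haddl, fun f g h => ?_, hsmull, fun r f g => ?_, fun f g h => ?_, hpos,
    fun a b c hab hc => ⟨hdis a b c hab hc, hcomm c a ▸ hdis a b c hab hc⟩⟩
  · rw [hcomm f, haddl, hcomm g, hcomm h]
  · rw [hcomm f, hsmull, hcomm g]
  · refine (hP (P f g) h).unique ?_
    convert hP f (P g h) using 3 with i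
    rw [hcoord, hcoord]
    ring

theorem norm_term_le (hX : IsALSpace X) (he : IsMaximalAtomFamily e) (w : lp (fun _ : I => ℝ) ⊤)
    (f g : X) (i : I) : ‖(w i * coordFunctional (e i) f * coordFunctional (e i) g) • e i‖ ≤
      |coordFunctional (e i) f| * (‖w‖ * ‖g‖) := by
  rw [norm_smul, he.norm_eq_one, mul_one, norm_mul, norm_mul, mul_comm ‖w i‖, mul_assoc,
    Real.norm_eq_abs]
  gcongr
  · exact lp.norm_apply_le_norm ENNReal.top_ne_zero w i
  · exact he.abs_coordFunctional_le hX g i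

theorem exists_product (hX : IsALSpace X) (he : IsMaximalAtomFamily e)
    (w : lp (fun _ : I => ℝ) ⊤) : ∃ P : X → X → X, IsWeightedProduct e w P :=
  ⟨fun _ _ => ∑' _, _, fun f g => (Summable.of_norm_bounded
    ((he.summable_abs_coordFunctional hX f).mul_right _) (norm_term_le hX he w f g)).hasSum⟩

theorem norm_le (hX : IsALSpace X) (he : IsMaximalAtomFamily e) (hP : IsWeightedProduct e w P)
    (f g : X) : ‖P f g‖ ≤ ‖w‖ * ‖f‖ * ‖g‖ := by
  have hs := (he.summable_abs_coordFunctional hX f).mul_right (‖w‖ * ‖g‖)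
  rw [← (hP f g).tsum_eq]
  refine (tsum_of_norm_bounded hs.hasSum (norm_term_le hX he w f g)).trans ?_
  rw [tsum_mul_right]
  calc _ ≤ ‖f‖ * (‖w‖ * ‖g‖) := by
        gcongr
        exact he.tsum_abs_coordFunctional_le hX f
    _ = _ := by ring

theorem isSubmultiplicative_iff (hX : IsALSpace X) (he : IsMaximalAtomFamily e)
    (hP : IsWeightedProduct e w P) : IsSubmultiplicative P ↔ ‖w‖ ≤ 1 := by
  refine ⟨fun h => lp.norm_le_of_forall_le zero_le_one fun i => ?_, fun h f g => ?_⟩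
  -- The weight `w i` is the `i`-th coordinate of `P (e i) (e i)`.
  · have h1 := he.coordFunctional_of_hasSum (hP (e i) (e i)) i
    rw [coordFunctional_self (he.isLatticeAtom i) (he.ne_zero i), mul_one, mul_one] at h1
    rw [← h1, Real.norm_eq_abs]
    refine (he.abs_coordFunctional_le hX _ i).trans ((h (e i) (e i)).trans_eq ?_)
    rw [he.norm_eq_one, mul_one]
  · refine (hP.norm_le hX he f g).trans ?_
    gcongr
    exact mul_le_of_le_one_left (norm_nonneg f) h

end IsWeightedProduct

end Main

theorem theorem5p2 {X : Type*} [NormedAddCommGroup X] [Lattice X] [IsOrderedAddMonoid X]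
    [HasSolidNorm X] [NormedSpace ℝ X] [IsOrderedModule ℝ X] [CompleteSpace X]
    (hX : IsALSpace X) {I : Type*} (e : I → X) (he : IsMaximalAtomFamily e) :
    -- the f-algebra products are exactly the weighted products with weight in `ℓ∞(I)₊`
    (∀ P : X → X → X, IsFAlgebraProduct P ↔
      ∃ w : lp (fun _ : I => ℝ) ⊤, (∀ i, 0 ≤ w i) ∧ IsWeightedProduct e w P) ∧
    -- every weight in `ℓ∞(I)₊` does define a product
    (∀ w : lp (fun _ : I => ℝ) ⊤, (∀ i, 0 ≤ w i) → ∃ P : X → X → X, IsWeightedProduct e w P) ∧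
    -- such a product is submultiplicative if and only if its weight has norm at most one
    (∀ (w : lp (fun _ : I => ℝ) ⊤) (P : X → X → X), (∀ i, 0 ≤ w i) → IsWeightedProduct e w P →
      (IsSubmultiplicative P ↔ ‖w‖ ≤ 1)) :=
  ⟨fun _ => ⟨fun hP => hP.exists_weight hX he, fun ⟨_, hw, hP⟩ => hP.isFAlgebraProduct he hw⟩,
    fun w _ => IsWeightedProduct.exists_product hX he w,
    fun _ _ _ hP => hP.isSubmultiplicative_iff hX he⟩
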